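/- Let $L=(L_t)_{t\ge 0}$ be a real-valued Lévy process on a probability space (that is, $L_0=0$ almost surely, $L$ has stationary and independent increments, and almost surely its paths are right-continuous with left limits), and suppose that for every $t>0$ the law of $L_t$ is absolutely continuous with respect to Lebesgue measure. Let $\Psi:\mathbb R\to\mathbb C$ be its characteristic exponent, i.e. $\mathbb E[e^{i\xi L_t}]=e^{t\Psi(\xi)}$ for all $t\ge 0$ and $\xi\in\mathbb R$, and let $$\beta=\inf\Big\{q>0:\ \frac{|\Psi(\xi)|}{|\xi|^q}\to 0 \text{ as } |\xi|\to\infty\Big\}$$ be its Blumenthal–Getoor index. Suppose that $\mathbb E[|L_1|^p]<\infty$ for some $p>0$. For an absolutely continuous random variable $X$ with density $p_X$, let $h(X)=-\int_{\mathbb R}p_X(x)\log p_X(x)\,dx$ (with $0\log 0=0$) denote its differential entropy, which is well-defined in $[-\infty,\infty]$ when the positive or the negative part of the integrand is integrable. Then $h(L_t)$ is well-defined in $[-\infty,\infty)$ for every $t>0$, and $$\limsup_{t\to 0^+}\frac{h(L_t)}{\log(1/t)}\le-\frac1\beta,$$ with the convention $1/0=\infty$. In particular, if $\beta=0$, then $$\lim_{t\to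 0^+}\frac{h(L_t)}{\log(1/t)}=-\infty.$$ -/

import Mathlib

open MeasureTheory ProbabilityTheory Filter Topology
open scoped NNReal ENNReal

namespace LevyEntropy

/-- `L = (L_t)_{t ≥ 0}` is a real Lévy process on the probability space `(Ω, P)`. -/
structure IsLevyProcess {Ω : Type*} [MeasurableSpace Ω] (P : Measure Ω) (L : ℝ≥0 → Ω → ℝ) :
    Prop where
  measurable : ∀ t, Measurable (L t)
  zero : ∀ᵐ ω ∂P, L 0 ω = 0
  stationary : ∀ s t : ℝ≥0, IdentDistrib (L s) (fun ω => L (t + s) ω - L t ω) P P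
  indep : HasIndepIncrements L P
  cadlag : ∀ᵐ ω ∂P, ∀ t : ℝ≥0,
    Tendsto (fun s => L s ω) (𝓝[>] t) (𝓝 (L t ω)) ∧
      ∃ l : ℝ, Tendsto (fun s => L s ω) (𝓝[<] t) (𝓝 l)

/-- `Ψ` is a characteristic exponent of `L`: `E[exp(i ξ L_t)] = exp(t Ψ(ξ))` for all `t ≥ 0` and
all real `ξ`. Requiring this for all times determines `Ψ` uniquely (no choice of a branch of the
complex logarithm is left), see `IsCharExponent.unique`. -/
def IsCharExponent {Ω : Type*} [MeasurableSpace Ω] (P : Measure Ω) (L : ℝ≥0 → Ω → ℝ)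
    (Ψ : ℝ → ℂ) : Prop :=
  ∀ (t : ℝ≥0) (ξ : ℝ), charFun (P.map (L t)) ξ = Complex.exp (((t : ℝ) : ℂ) * Ψ ξ)

theorem IsCharExponent.unique {Ω : Type*} [MeasurableSpace Ω] {P : Measure Ω}
    {L : ℝ≥0 → Ω → ℝ} {Ψ₁ Ψ₂ : ℝ → ℂ} (h₁ : IsCharExponent P L Ψ₁)
    (h₂ : IsCharExponent P L Ψ₂) : Ψ₁ = Ψ₂ := by
  funext ξ
  have key : ∀ Ψ : ℝ → ℂ, IsCharExponent P L Ψ →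
      HasDerivWithinAt (fun t : ℝ => charFun (P.map (L t.toNNReal)) ξ) (Ψ ξ) (Set.Ici 0) 0 := by
    intro Ψ h
    have h0 : HasDerivAt (fun t : ℝ => Complex.exp ((t : ℂ) * Ψ ξ)) (Ψ ξ) 0 := by
      have h1 : HasDerivAt (fun t : ℝ => (t : ℂ) * Ψ ξ) (1 * Ψ ξ) 0 :=
        (Complex.ofRealCLM.hasDerivAt (x := (0 : ℝ))).mul_const (Ψ ξ)
      simpa using h1.cexp
    refine h0.hasDerivWithinAt.congr ?_ ?_
    · intro t ht
      rw [h, Real.coe_toNNReal t ht]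
    · rw [h, Real.coe_toNNReal 0 le_rfl]
  exact (uniqueDiffOn_Ici (0 : ℝ) 0 Set.self_mem_Ici).eq_deriv _ (key Ψ₁ h₁) (key Ψ₂ h₂)

/-- The characteristic exponent of `L` (every Lévy process has exactly one). -/
noncomputable def charExponent {Ω : Type*} [MeasurableSpace Ω] (P : Measure Ω)
    (L : ℝ≥0 → Ω → ℝ) : ℝ → ℂ :=
  Classical.epsilon (IsCharExponent P L)

/-- The Blumenthal–Getoor index `inf {p > 0 : |Ψ(ξ)| / |ξ|^p → 0 as |ξ| → ∞}`, as an element of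
`[0, ∞]`, so that the infimum of an empty set would be `∞`. -/
noncomputable def bgIndex {Ω : Type*} [MeasurableSpace Ω] (P : Measure Ω)
    (L : ℝ≥0 → Ω → ℝ) : ℝ≥0∞ :=
  sInf (ENNReal.ofReal '' {p : ℝ | 0 < p ∧
    Tendsto (fun ξ : ℝ => ‖charExponent P L ξ‖ / |ξ| ^ p) (cocompact ℝ) (𝓝 0)})

/-- The integrand `- p_X log p_X` of the differential entropy of `X`, with `0 log 0 = 0`. -/
noncomputable def entropyIntegrand {Ω : Type*} [MeasurableSpace Ω] (P : Measure Ω) (X : Ω → ℝ)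
    (x : ℝ) : ℝ :=
  Real.negMulLog (pdf X P volume x).toReal

/-- The integral of the positive part of `- p_X log p_X`. -/
noncomputable def entropyPos {Ω : Type*} [MeasurableSpace Ω] (P : Measure Ω) (X : Ω → ℝ) : ℝ≥0∞ :=
  ∫⁻ x, ENNReal.ofReal (entropyIntegrand P X x)

/-- The integral of the negative part of `- p_X log p_X`. -/
noncomputable def entropyNeg {Ω : Type*} [MeasurableSpace Ω] (P : Measure Ω) (X : Ω → ℝ) : ℝ≥0∞ :=
  ∫⁻ x, ENNReal.ofReal (-entropyIntegrand P X x)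

/-- The differential entropy of `X` is well-defined in `[-∞, ∞]`: `X` is absolutely continuous and
the positive or the negative part of `- p_X log p_X` is integrable. -/
def HasDiffEntropy {Ω : Type*} [MeasurableSpace Ω] (P : Measure Ω) (X : Ω → ℝ) : Prop :=
  HasPDF X P volume ∧ (entropyPos P X ≠ ∞ ∨ entropyNeg P X ≠ ∞)

/-- The differential entropy `h(X) = - ∫ p_X log p_X`, with values in `[-∞, ∞]`; meaningful when
`HasDiffEntropy P X` holds. -/
noncomputable def diffEntropy {Ω : Type*} [MeasurableSpace Ω] (P : Measure Ω) (X : Ω → ℝ) : EReal :=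
  (entropyPos P X : EReal) - (entropyNeg P X : EReal)

end LevyEntropy

/-! By Gibbs' inequality, entropy is at most cross-entropy. Testing against the Cauchy density of
scale `t ^ α` gives `h(L_t) ≤ log π - α log(1/t) + 2 E log(1 + |t ^ (-α) L_t|)`
(`diffEntropy_le_of_logMoment_ne_top`). The heavy tail of the Cauchy law means that only a
logarithmic moment is needed, and the `p`-th moment of `L_1` supplies it.

The last expectation is `o(log(1/t))` once `t ^ (-α) L_t → 0` in probability: off the event `|t ^
(-α) L_t| > 1` the logarithm is at most `log 2`; on it, it is at most `log(1 + t ^ (-α)) + log(1 +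
|L_t|)`, where the first term is weighted by a vanishing probability and the second has bounded
expectation for small `t` (`exists_eventually_logMoment_le`). So the limsup is at most `-α`.

If `|Ψ(ξ)| / |ξ| ^ q → 0`, then `α = 1/q` is allowed (`tendsto_measureReal_abs_gt_scaled`). The
supremum of `1/q` over such `q` is `1/β`. -/

namespace LevyEntropy

/-! ### Existence of the characteristic exponent -/

/-- A contraction semigroup in `ℂ` that is right-continuous at `0` is an exponential. -/
theorem exists_eq_exp_of_semigroup {φ : ℝ≥0 → ℂ} (h0 : φ 0 = 1)
    (hmul : ∀ s t, φ (s + t) = φ s * φ t) (hle : ∀ t, ‖φ t‖ ≤ 1)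
    (hlim : Tendsto φ (𝓝[>] 0) (𝓝 1)) :
    ∃ ψ : ℂ, ∀ t : ℝ≥0, φ t = Complex.exp (((t : ℝ) : ℂ) * ψ) := by
  have hφ0 : ContinuousAt φ 0 := by
    have : ContinuousWithinAt φ (Set.Ici 0) 0 := by
      rw [← continuousWithinAt_Ioi_iff_Ici, ContinuousWithinAt, h0]
      exact hlim
    rwa [show (Set.Ici (0 : ℝ≥0)) = Set.univ from Set.Ici_bot, continuousWithinAt_univ] at this
  -- The contraction property carries continuity from `0` to every time.
  have hdist : ∀ s t, ‖φ s - φ t‖ ≤ ‖φ (nndist s t) - 1‖ := by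
    have key : ∀ s t : ℝ≥0, s ≤ t → ‖φ t - φ s‖ ≤ ‖φ (nndist s t) - 1‖ := by
      intro s t hst
      obtain ⟨r, rfl⟩ := exists_add_of_le hst
      have : nndist s (s + r) = r := by
        apply NNReal.eq
        rw [coe_nndist, NNReal.dist_eq]
        simp
      rw [this, hmul, show φ s * φ r - φ s = φ s * (φ r - 1) by ring, norm_mul]
      exact mul_le_of_le_one_left (norm_nonneg _) (hle s)
    intro s t
    rcases le_total s t with h | h
    · rw [norm_sub_rev]
      exact key s t h
    · rw [nndist_comm]
      exact key t s h
  have hcont : Continuous φ := by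
    rw [continuous_iff_continuousAt]
    intro t
    rw [ContinuousAt, tendsto_iff_norm_sub_tendsto_zero]
    have h1 : Tendsto (fun s => ‖φ (nndist s t) - 1‖) (𝓝 t) (𝓝 0) := by
      have h2 : Tendsto (fun s => nndist s t) (𝓝 t) (𝓝 0) := by
        have : Continuous fun s : ℝ≥0 => nndist s t := by fun_prop
        simpa using this.tendsto t
      have h3 := (hφ0.tendsto.comp h2).sub_const 1
      rw [h0, sub_self] at h3
      simpa using h3.norm
    exact squeeze_zero (fun _ => norm_nonneg _) (fun s => hdist s t) h1
  set g : ℝ → ℂ := fun x => φ x.toNNReal with hg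
  have gcont : Continuous g := hcont.comp continuous_real_toNNReal
  have gmul : ∀ x y : ℝ, 0 ≤ x → 0 ≤ y → g (x + y) = g x * g y := by
    intro x y hx hy
    simp only [hg]
    rw [Real.toNNReal_add hx hy, hmul]
  have g0 : g 0 = 1 := by simp [hg, h0]
  set F : ℝ → ℂ := fun x => ∫ s in (0 : ℝ)..x, g s with hF
  have hFd : ∀ x, HasDerivAt F (g x) x := fun x =>
    (gcont.integral_hasStrictDerivAt 0 x).hasDerivAt
  -- A nonzero `F a` lets `g` be written as a difference of primitives divided by `F a`, so that the
  -- merely continuous `g` becomes differentiable.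
  obtain ⟨a, hFa, ha⟩ : ∃ a, F a ≠ 0 ∧ 0 < a := by
    have h1 : ∀ᶠ z in 𝓝[>] (0 : ℝ), F z ≠ 0 :=
      ((hFd 0).eventually_ne (by rw [g0]; exact one_ne_zero)).filter_mono
        (nhdsWithin_mono _ fun x hx => ne_of_gt hx)
    exact (h1.and self_mem_nhdsWithin).exists
  have hgF : ∀ x, 0 ≤ x → g x = (F (x + a) - F x) / F a := by
    intro x hx
    rw [eq_div_iff hFa]
    simp only [hF]
    rw [intervalIntegral.integral_interval_sub_left (gcont.intervalIntegrable _ _)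
      (gcont.intervalIntegrable _ _), ← intervalIntegral.integral_const_mul]
    have := intervalIntegral.integral_comp_add_left (a := 0) (b := a) g x
    rw [add_zero] at this
    rw [← this]
    refine intervalIntegral.integral_congr fun s hs => ?_
    rw [Set.uIcc_of_le ha.le] at hs
    exact (gmul x s hx hs.1).symm
  set ψ : ℂ := (g a - 1) / F a with hψ
  -- On `x ≥ 0` this is `g x * exp (-x ψ)`; since `g' = ψ g` there, it is constant.
  set k : ℝ → ℂ := fun x => (F (x + a) - F x) / F a * Complex.exp (-((x : ℂ) * ψ)) with hk
  have hkd : ∀ x, 0 ≤ x → HasDerivAt k 0 x := by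
    intro x hx
    have h1 : HasDerivAt (fun x => (F (x + a) - F x) / F a) ((g (x + a) - g x) / F a) x :=
      (((hFd (x + a)).comp_add_const x a).sub (hFd x)).div_const _
    have h2 : HasDerivAt (fun x : ℝ => Complex.exp (-((x : ℂ) * ψ)))
        (Complex.exp (-((x : ℂ) * ψ)) * (-(1 * ψ))) x :=
      ((Complex.ofRealCLM.hasDerivAt (x := x)).mul_const ψ).neg.cexp
    refine (h1.mul h2).congr_deriv ?_
    rw [← hgF x hx, gmul x a hx ha.le, hψ]
    field_simp
    ring
  refine ⟨ψ, fun t => ?_⟩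
  have hconst := constant_of_has_deriv_right_zero (f := k) (a := 0) (b := t)
    (fun x hx => (hkd x hx.1).continuousAt.continuousWithinAt)
    (fun x hx => (hkd x hx.1).hasDerivWithinAt) t ⟨t.2, le_rfl⟩
  simp only [hk] at hconst
  rw [← hgF t t.2, ← hgF 0 le_rfl, g0] at hconst
  have hgt : g t = φ t := by simp [hg]
  rw [hgt, Complex.exp_neg] at hconst
  have hne := Complex.exp_ne_zero (((t : ℝ) : ℂ) * ψ)
  simpa [← div_eq_mul_inv, div_eq_iff hne] using hconst

theorem IsLevyProcess.indepFun_increment {Ω : Type*} [MeasurableSpace Ω] {P : Measure Ω}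
    {L : ℝ≥0 → Ω → ℝ} (hL : IsLevyProcess P L) (t s : ℝ≥0) :
    IndepFun (L t) (fun ω => L (t + s) ω - L t ω) P :=
  hL.indep.indepFun_eval_sub (zero_le (a := t)) le_self_add hL.zero

section Levy

variable {Ω : Type*} [MeasurableSpace Ω] {P : Measure Ω} [IsProbabilityMeasure P]
  {L : ℝ≥0 → Ω → ℝ}

theorem IsLevyProcess.charFun_add (hL : IsLevyProcess P L) (t s : ℝ≥0) (ξ : ℝ) :
    charFun (P.map (L (t + s))) ξ = charFun (P.map (L t)) ξ * charFun (P.map (L s)) ξ := by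
  have h := (hL.indepFun_increment t s).charFun_map_fun_add_eq_mul
    (hL.measurable t).aemeasurable
    ((hL.measurable (t + s)).sub (hL.measurable t)).aemeasurable
  rw [show (fun ω => L t ω + (L (t + s) - L t) ω) = L (t + s) by ext; simp] at h
  rw [h, (hL.stationary s t).map_eq, Pi.mul_apply]
  rfl

theorem IsLevyProcess.charFun_zero (hL : IsLevyProcess P L) (ξ : ℝ) :
    charFun (P.map (L 0)) ξ = 1 := by
  have : P.map (L 0) = P.map (fun _ => (0 : ℝ)) := Measure.map_congr hL.zero
  rw [this]
  simp

theorem IsLevyProcess.tendsto_charFun (hL : IsLevyProcess P L) (ξ : ℝ) :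
    Tendsto (fun t => charFun (P.map (L t)) ξ) (𝓝[>] 0) (𝓝 1) := by
  rw [← hL.charFun_zero ξ]
  have hrw : ∀ t, charFun (P.map (L t)) ξ = ∫ ω, Complex.exp (ξ * L t ω * Complex.I) ∂P := by
    intro t
    rw [charFun_apply_real, integral_map (hL.measurable t).aemeasurable (by fun_prop)]
  simp_rw [hrw]
  refine tendsto_integral_filter_of_dominated_convergence (fun _ => 1) ?_ ?_ ?_ ?_
  · refine Eventually.of_forall fun t => ?_
    have := hL.measurable t
    exact Measurable.aestronglyMeasurable (by fun_prop)
  · refine Eventually.of_forall fun t => Eventually.of_forall fun ω => ?_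
    have := Complex.norm_exp_ofReal_mul_I (ξ * L t ω)
    push_cast at this
    exact this.le
  · exact integrable_const _
  · filter_upwards [hL.cadlag] with ω hω
    have h1 := (hω 0).1
    have h2 : Continuous fun x : ℝ => Complex.exp (ξ * x * Complex.I) := by fun_prop
    exact (h2.tendsto _).comp h1

/-- `charExponent` is an arbitrary choice unless some exponent exists; the semigroup lemma, applied
at each frequency, provides one. -/
theorem IsLevyProcess.isCharExponent (hL : IsLevyProcess P L) :
    IsCharExponent P L (charExponent P L) := by
  have h : ∀ ξ : ℝ, ∃ ψ : ℂ, ∀ t : ℝ≥0,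
      charFun (P.map (L t)) ξ = Complex.exp (((t : ℝ) : ℂ) * ψ) := fun ξ => by
    refine exists_eq_exp_of_semigroup (hL.charFun_zero ξ)
      (fun s t => hL.charFun_add s t ξ) (fun t => ?_) (hL.tendsto_charFun ξ)
    have := Measure.isProbabilityMeasure_map (hL.measurable t).aemeasurable (μ := P)
    exact norm_charFun_le_one ξ
  choose Ψ hΨ using h
  exact Classical.epsilon_spec (p := IsCharExponent P L) ⟨Ψ, fun t ξ => hΨ ξ t⟩

/-! ### Convergence to zero in probability -/

/-- If the characteristic functions tend to `1` off the origin, the variables tend to `0` in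
probability. -/
theorem tendsto_measureReal_abs_gt {ι : Type*} {l : Filter ι} [l.IsCountablyGenerated]
    {X : ι → Ω → ℝ} (hX : ∀ i, Measurable (X i))
    (h : ∀ ξ ≠ 0, Tendsto (fun i => charFun (P.map (X i)) ξ) l (𝓝 1)) :
    Tendsto (fun i => P.real {ω | 1 < |X i ω|}) l (𝓝 0) := by
  have hprob : ∀ i, IsProbabilityMeasure (P.map (X i)) := fun i =>
    Measure.isProbabilityMeasure_map (hX i).aemeasurable
  -- The tail `P(1 < |X|)` is bounded by half the norm of the integral of `1 - charFun` over `[-2,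
  -- 2]`; the origin is a null set there.
  have hlim : Tendsto (fun i => ∫ t in (-2 * (1 : ℝ)⁻¹)..(2 * (1 : ℝ)⁻¹),
      (1 - charFun (P.map (X i)) t)) l (𝓝 (∫ _ in (-2 * (1 : ℝ)⁻¹)..(2 * (1 : ℝ)⁻¹), (0 : ℂ))) := by
    refine intervalIntegral.tendsto_integral_filter_of_dominated_convergence (fun _ => 2) ?_ ?_ ?_ ?_
    · exact Eventually.of_forall fun i =>
        (measurable_const.sub measurable_charFun).aestronglyMeasurable
    · refine Eventually.of_forall fun i => Eventually.of_forall fun t _ => ?_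
      refine (norm_sub_le _ _).trans ?_
      have := norm_charFun_le_one (μ := P.map (X i)) t
      rw [norm_one]
      linarith
    · exact intervalIntegrable_const
    · filter_upwards [Measure.ae_ne volume 0] with t ht _
      simpa using (h t ht).const_sub 1
  rw [intervalIntegral.integral_zero] at hlim
  have hlim' := (hlim.norm.const_mul (2⁻¹ * 1 : ℝ))
  rw [norm_zero, mul_zero] at hlim'
  refine squeeze_zero (fun _ => measureReal_nonneg) (fun i => ?_) hlim'
  have := measureReal_abs_gt_le_integral_charFun (μ := P.map (X i)) one_pos
  rwa [map_measureReal_apply (hX i) (measurableSet_lt measurable_const (by fun_prop))] at this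

theorem IsLevyProcess.tendsto_measureReal_abs_gt (hL : IsLevyProcess P L) :
    Tendsto (fun t => P.real {ω | 1 < |L t ω|}) (𝓝[>] 0) (𝓝 0) :=
  LevyEntropy.tendsto_measureReal_abs_gt hL.measurable fun ξ _ => hL.tendsto_charFun ξ

/-- With `η = t ^ (-1/q) ξ` one has `t = |ξ| ^ q / |η| ^ q`, so the exponent of the scaled variable
satisfies `t |Ψ(η)| = |ξ| ^ q (|Ψ(η)| / |η| ^ q) → 0`. -/
theorem IsLevyProcess.tendsto_measureReal_abs_gt_scaled (hL : IsLevyProcess P L) {q : ℝ}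
    (hq : 0 < q)
    (h : Tendsto (fun ξ : ℝ => ‖charExponent P L ξ‖ / |ξ| ^ q) (cocompact ℝ) (𝓝 0)) :
    Tendsto (fun t : ℝ≥0 => P.real {ω | 1 < |(t : ℝ) ^ (-q⁻¹) * L t ω|}) (𝓝[>] 0) (𝓝 0) := by
  refine LevyEntropy.tendsto_measureReal_abs_gt (fun t => (hL.measurable t).const_mul _)
    fun ξ hξ => ?_
  simp_rw [charFun_map_mul_comp (hL.measurable _).aemeasurable, hL.isCharExponent _ _]
  rw [← Complex.exp_zero]
  refine (Complex.continuous_exp.tendsto 0).comp ?_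
  rw [tendsto_zero_iff_norm_tendsto_zero]
  have hcoe : Tendsto (fun t : ℝ≥0 => (t : ℝ)) (𝓝[>] 0) (𝓝[>] 0) := by
    refine tendsto_nhdsWithin_iff.2 ⟨?_, ?_⟩
    · exact (NNReal.continuous_coe.tendsto 0).mono_left nhdsWithin_le_nhds
    · filter_upwards [self_mem_nhdsWithin] with t ht
      exact NNReal.coe_pos.2 ht
  have hscale : Tendsto (fun t : ℝ≥0 => (t : ℝ) ^ (-q⁻¹) * ξ) (𝓝[>] 0) (cocompact ℝ) := by
    rw [← Metric.cobounded_eq_cocompact, ← tendsto_norm_atTop_iff_cobounded]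
    have h1 : Tendsto (fun t : ℝ≥0 => (t : ℝ) ^ (-q⁻¹)) (𝓝[>] 0) atTop :=
      (tendsto_rpow_neg_nhdsGT_zero (by simpa using hq)).comp hcoe
    have h2 := h1.atTop_mul_const (norm_pos_iff.2 hξ)
    refine h2.congr fun t => ?_
    rw [norm_mul, Real.norm_of_nonneg (Real.rpow_nonneg (NNReal.coe_nonneg t) _)]
  have h3 := (h.comp hscale).mul_const (|ξ| ^ q)
  rw [zero_mul] at h3
  refine h3.congr' ?_
  filter_upwards [self_mem_nhdsWithin] with t ht
  have ht' : (0 : ℝ) < t := NNReal.coe_pos.2 ht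
  have hξ' : |ξ| ^ q ≠ 0 := (Real.rpow_pos_of_pos (abs_pos.2 hξ) q).ne'
  have ht2 : ((t : ℝ) ^ (-q⁻¹)) ^ q = (t : ℝ)⁻¹ := by
    rw [← Real.rpow_mul ht'.le, neg_mul, inv_mul_cancel₀ hq.ne', Real.rpow_neg_one]
  simp only [Function.comp]
  rw [abs_mul, abs_of_nonneg (Real.rpow_nonneg ht'.le _),
    Real.mul_rpow (Real.rpow_nonneg ht'.le _) (abs_nonneg _), ht2, norm_mul, Complex.norm_real,
    Real.norm_of_nonneg ht'.le]
  field_simp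

end Levy

/-! ### Inequalities for `log (1 + |x|)` -/

theorem log_one_add_abs_nonneg (x : ℝ) : 0 ≤ Real.log (1 + |x|) :=
  Real.log_nonneg (by linarith [abs_nonneg x])

theorem log_one_add_abs_mono {x y : ℝ} (h : |x| ≤ |y|) :
    Real.log (1 + |x|) ≤ Real.log (1 + |y|) :=
  Real.log_le_log (by positivity) (by linarith)

theorem log_one_add_abs_add_le (x y : ℝ) :
    Real.log (1 + |x + y|) ≤ Real.log (1 + |x|) + Real.log (1 + |y|) := by
  rw [← Real.log_mul (by positivity) (by positivity)]
  refine Real.log_le_log (by positivity) ?_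
  nlinarith [abs_add_le x y, mul_nonneg (abs_nonneg x) (abs_nonneg y)]

theorem log_one_add_abs_mul_le (x y : ℝ) :
    Real.log (1 + |x * y|) ≤ Real.log (1 + |x|) + Real.log (1 + |y|) := by
  rw [← Real.log_mul (by positivity) (by positivity), abs_mul]
  refine Real.log_le_log (by positivity) ?_
  nlinarith [abs_nonneg x, abs_nonneg y]

theorem log_one_add_sq_le (x : ℝ) : Real.log (1 + x ^ 2) ≤ 2 * Real.log (1 + |x|) := by
  have h : 2 * Real.log (1 + |x|) = Real.log ((1 + |x|) ^ 2) := by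
    rw [Real.log_pow]
    norm_num
  rw [h]
  refine Real.log_le_log (by positivity) ?_
  nlinarith [abs_nonneg x, sq_abs x]

theorem log_one_add_abs_le_rpow {p : ℝ} (hp : 0 < p) (x : ℝ) :
    Real.log (1 + |x|) ≤ Real.log 2 + |x| ^ p / p := by
  have h2 : 0 ≤ |x| ^ p / p := by positivity
  rcases le_total |x| 1 with h | h
  · have := Real.log_le_log (by positivity) (show 1 + |x| ≤ 2 by linarith)
    linarith
  · have h1 : Real.log (1 + |x|) ≤ Real.log (2 * |x|) :=
      Real.log_le_log (by positivity) (by linarith)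
    rw [Real.log_mul two_ne_zero (by positivity)] at h1
    have := Real.log_le_rpow_div (abs_nonneg x) hp
    linarith

/-! ### Logarithmic moments -/

section

variable {Ω : Type*} [MeasurableSpace Ω] {P : Measure Ω} {L : ℝ≥0 → Ω → ℝ}

/-- The logarithmic moment of a random variable. -/
noncomputable def logMoment (P : Measure Ω) (X : Ω → ℝ) : ℝ≥0∞ :=
  ∫⁻ ω, ENNReal.ofReal (Real.log (1 + |X ω|)) ∂P

theorem integrable_of_logMoment_ne_top {X : Ω → ℝ} (hX : Measurable X)
    (h : logMoment P X ≠ ∞) : Integrable (fun ω => Real.log (1 + |X ω|)) P :=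
  (lintegral_ofReal_ne_top_iff_integrable (Measurable.aestronglyMeasurable (by fun_prop))
    (Eventually.of_forall fun _ => log_one_add_abs_nonneg _)).1 h

theorem integral_eq_toReal_logMoment {X : Ω → ℝ} (hX : Measurable X) :
    ∫ ω, Real.log (1 + |X ω|) ∂P = (logMoment P X).toReal :=
  integral_eq_lintegral_of_nonneg_ae (Eventually.of_forall fun _ => log_one_add_abs_nonneg _)
    (Measurable.aestronglyMeasurable (by fun_prop))

theorem logMoment_add_le {X Y : Ω → ℝ} (hX : Measurable X) :
    logMoment P (fun ω => X ω + Y ω) ≤ logMoment P X + logMoment P Y := by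
  unfold logMoment
  rw [← lintegral_add_left (by fun_prop)]
  refine lintegral_mono fun ω => ?_
  dsimp only
  rw [← ENNReal.ofReal_add (log_one_add_abs_nonneg _) (log_one_add_abs_nonneg _)]
  exact ENNReal.ofReal_le_ofReal (log_one_add_abs_add_le _ _)

theorem IsLevyProcess.logMoment_increment (hL : IsLevyProcess P L) (t s : ℝ≥0) :
    logMoment P (fun ω => L (t + s) ω - L t ω) = logMoment P (L s) := by
  have h : Measurable fun x : ℝ => ENNReal.ofReal (Real.log (1 + |x|)) := by fun_prop
  exact (((hL.stationary s t).comp h).lintegral_eq).symm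

theorem IsLevyProcess.logMoment_add_le (hL : IsLevyProcess P L) (t s : ℝ≥0) :
    logMoment P (L (t + s)) ≤ logMoment P (L t) + logMoment P (L s) := by
  have h := LevyEntropy.logMoment_add_le (P := P) (Y := fun ω => L (t + s) ω - L t ω)
    (hL.measurable t)
  rw [hL.logMoment_increment t s] at h
  simpa using h

variable [IsProbabilityMeasure P]

theorem logMoment_ne_top_of_integrable_rpow {X : Ω → ℝ} (hX : Measurable X) {p : ℝ} (hp : 0 < p)
    (h : Integrable (fun ω => |X ω| ^ p) P) : logMoment P X ≠ ∞ := by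
  refine (lintegral_ofReal_ne_top_iff_integrable (Measurable.aestronglyMeasurable (by fun_prop))
    (Eventually.of_forall fun _ => log_one_add_abs_nonneg _)).2 ?_
  refine Integrable.mono' ((integrable_const (Real.log 2)).add (h.div_const p))
    (Measurable.aestronglyMeasurable (by fun_prop)) (Eventually.of_forall fun ω => ?_)
  rw [Real.norm_of_nonneg (log_one_add_abs_nonneg _)]
  exact log_one_add_abs_le_rpow hp _

/-- The logarithmic moment of a summand is controlled by that of an independent sum. -/
theorem logMoment_mul_measure_le {X Y : Ω → ℝ} (hX : Measurable X) (hY : Measurable Y)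
    (hXY : IndepFun X Y P) (M : ℝ) :
    logMoment P X * P {ω | |Y ω| ≤ M} ≤
      logMoment P (fun ω => X ω + Y ω) + ENNReal.ofReal (Real.log (1 + |M|)) := by
  set s : Set ℝ := {y | |y| ≤ M} with hs_def
  have hs : MeasurableSet s := measurableSet_le (by fun_prop) measurable_const
  set f : ℝ → ℝ≥0∞ := fun x => ENNReal.ofReal (Real.log (1 + |x|)) with hf_def
  have hf : Measurable f := by fun_prop
  set g : ℝ → ℝ≥0∞ := s.indicator 1 with hg_def
  have hg : Measurable g := measurable_one.indicator hs
  have hprod := lintegral_mul_eq_lintegral_mul_lintegral_of_indepFun (μ := P)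
    (hf.comp hX) (hg.comp hY) (hXY.comp hf hg)
  have hgP : ∫⁻ ω, (g ∘ Y) ω ∂P = P {ω | |Y ω| ≤ M} := by
    have : g ∘ Y = (Y ⁻¹' s).indicator 1 := rfl
    rw [this, lintegral_indicator_one (hY hs)]
    rfl
  rw [hgP] at hprod
  calc logMoment P X * P {ω | |Y ω| ≤ M} = ∫⁻ ω, ((f ∘ X) * (g ∘ Y)) ω ∂P := hprod.symm
    _ ≤ ∫⁻ ω, (f (X ω + Y ω) + f M) ∂P := by
      refine lintegral_mono fun ω => ?_
      simp only [Pi.mul_apply, Function.comp, hg_def, Set.indicator_apply, Pi.one_apply]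
      split_ifs with h
      · rw [mul_one, hf_def]
        dsimp only
        rw [← ENNReal.ofReal_add (log_one_add_abs_nonneg _) (log_one_add_abs_nonneg _)]
        refine ENNReal.ofReal_le_ofReal ?_
        have h1 := log_one_add_abs_add_le (X ω + Y ω) (-Y ω)
        have h2 : Real.log (1 + |Y ω|) ≤ Real.log (1 + |M|) :=
          log_one_add_abs_mono (le_trans h (le_abs_self M))
        rw [add_neg_cancel_right, abs_neg] at h1
        linarith
      · simp
    _ = logMoment P (fun ω => X ω + Y ω) + ENNReal.ofReal (Real.log (1 + |M|)) := by
      rw [lintegral_add_right _ measurable_const]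
      simp [logMoment, hf_def]

/-- `L 1` is `L t` plus an independent increment that, for small `t`, stays in a fixed interval with
probability at least `1/2`; hence the logarithmic moment of `L t` is controlled by that of `L 1`. -/
theorem IsLevyProcess.exists_eventually_logMoment_le (hL : IsLevyProcess P L)
    (h1 : logMoment P (L 1) ≠ ∞) :
    ∃ K : ℝ≥0∞, K ≠ ∞ ∧ ∀ᶠ t in 𝓝[>] 0, logMoment P (L t) ≤ K := by
  -- The `3/4` here less the `1/4` in `hsmall` leaves the `1/2` of `hprob`.
  obtain ⟨n, hn⟩ : ∃ n : ℕ, 3 / 4 < P.real {ω | |L 1 ω| ≤ n} := by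
    have hmono : Monotone fun n : ℕ => {ω | |L 1 ω| ≤ n} := fun m n hmn ω hω =>
      le_trans (show |L 1 ω| ≤ m from hω) (Nat.cast_le.2 hmn)
    have hU : ⋃ n : ℕ, {ω | |L 1 ω| ≤ n} = Set.univ :=
      Set.eq_univ_of_forall fun ω =>
      Set.mem_iUnion.2 (exists_nat_ge |L 1 ω|)
    have hlim := tendsto_measure_iUnion_atTop (μ := P) hmono
    rw [hU, measure_univ] at hlim
    have hlim' := (ENNReal.tendsto_toReal ENNReal.one_ne_top).comp hlim
    have := hlim'.eventually (lt_mem_nhds (show (3 / 4 : ℝ) < ENNReal.toReal 1 by norm_num))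
    exact this.exists
  set A : ℝ≥0∞ := logMoment P (L 1) + ENNReal.ofReal (Real.log (1 + |(n : ℝ) + 1|)) with hA
  refine ⟨A * 2, ENNReal.mul_ne_top (by simp [hA, h1]) ENNReal.ofNat_ne_top, ?_⟩
  have hsmall : ∀ᶠ t in 𝓝[>] (0 : ℝ≥0), P.real {ω | 1 < |L t ω|} < 1 / 4 :=
    hL.tendsto_measureReal_abs_gt.eventually (gt_mem_nhds (by norm_num))
  have hle : ∀ᶠ t in 𝓝[>] (0 : ℝ≥0), t ≤ 1 :=
    mem_nhdsWithin_of_mem_nhds (Iic_mem_nhds one_pos)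
  filter_upwards [hsmall, hle] with t ht ht1
  obtain ⟨s, hs⟩ := exists_add_of_le ht1
  have hsub : {ω | |L 1 ω| ≤ n} ⊆
      {ω | |L 1 ω - L t ω| ≤ (n : ℝ) + 1} ∪ {ω | 1 < |L t ω|} := by
    intro ω hω
    by_cases h : 1 < |L t ω|
    · exact Or.inr h
    · refine Or.inl ?_
      have hω' : |L 1 ω| ≤ n := hω
      have := abs_sub (L 1 ω) (L t ω)
      simp only [Set.mem_ofPred_eq]
      linarith
  have hprob : (2 : ℝ≥0∞)⁻¹ ≤ P {ω | |L 1 ω - L t ω| ≤ (n : ℝ) + 1} := by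
    have hr := (measureReal_mono (μ := P) hsub).trans (measureReal_union_le _ _)
    have hr' : (2 : ℝ)⁻¹ ≤ P.real {ω | |L 1 ω - L t ω| ≤ (n : ℝ) + 1} := by linarith
    rw [← ENNReal.ofReal_le_ofReal_iff measureReal_nonneg, ofReal_measureReal,
      ENNReal.ofReal_inv_of_pos two_pos] at hr'
    simpa using hr'
  have key := logMoment_mul_measure_le (hL.measurable t)
    ((hL.measurable (t + s)).sub (hL.measurable t)) (hL.indepFun_increment t s) ((n : ℝ) + 1)
  simp only [Pi.sub_apply, add_sub_cancel] at key
  rw [← hs] at key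
  have key2 : logMoment P (L t) * 2⁻¹ ≤ A := le_trans (mul_le_mul_right hprob _) key
  rwa [← div_eq_mul_inv, ENNReal.div_le_iff two_ne_zero ENNReal.ofNat_ne_top] at key2

/-- Cutting `[0, t]` into equal pieces short enough for the small-time bound, subadditivity handles
every `t`. -/
theorem IsLevyProcess.logMoment_ne_top (hL : IsLevyProcess P L)
    (h1 : logMoment P (L 1) ≠ ∞) (t : ℝ≥0) (ht : 0 < t) : logMoment P (L t) ≠ ∞ := by
  obtain ⟨K, hK, hev⟩ := hL.exists_eventually_logMoment_le h1
  have hdiv : Tendsto (fun n : ℕ => t / ((n : ℝ≥0) + 1)) atTop (𝓝[>] 0) := by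
    refine tendsto_nhdsWithin_iff.2 ⟨?_, Eventually.of_forall fun n => ?_⟩
    · have h := (tendsto_one_div_add_atTop_nhds_zero_nat (𝕜 := ℝ≥0)).const_mul t
      simpa [div_eq_mul_inv] using h
    · exact div_pos ht (by positivity)
  obtain ⟨n, hn⟩ := (hdiv.eventually hev).exists
  have hmul : ∀ (m : ℕ) (s : ℝ≥0), logMoment P (L (((m : ℝ≥0) + 1) * s)) ≤
      ((m : ℝ≥0∞) + 1) * logMoment P (L s) := by
    intro m s
    induction m with
    | zero => simp
    | succ m ih =>
      push_cast
      rw [add_mul _ 1 s, add_mul _ 1 (logMoment P (L s)), one_mul, one_mul]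
      exact (hL.logMoment_add_le _ _).trans (by gcongr)
  have h := hmul n (t / ((n : ℝ≥0) + 1))
  rw [mul_div_cancel₀ _ (by positivity)] at h
  refine ne_top_of_le_ne_top ?_ (h.trans (mul_le_mul_right hn _))
  exact ENNReal.mul_ne_top (by simp) hK

/-! ### Entropy upper bounds -/

/-- Gibbs' inequality: the entropy is at most the cross-entropy relative to a (sub-)probability
density. -/
theorem entropyPos_ne_top_and_diffEntropy_le {X : Ω → ℝ} (hX : HasPDF X P volume)
    {g : ℝ → ℝ} (hg : ∀ x, 0 < g x) (hgm : Measurable g) (hgi : Integrable g)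
    (hg1 : ∫ x, g x ≤ 1) (hlog : Integrable (fun ω => Real.log (g (X ω))) P) :
    entropyPos P X ≠ ∞ ∧
      diffEntropy P X ≤ ((∫ ω, -Real.log (g (X ω)) ∂P : ℝ) : EReal) := by
  set ρ : ℝ → ℝ := fun x => (pdf X P volume x).toReal with hρ
  have hlogm : AEStronglyMeasurable (fun x => -Real.log (g x)) volume :=
    Measurable.aestronglyMeasurable (by fun_prop)
  have hone : AEStronglyMeasurable (fun _ => (1 : ℝ)) (volume : Measure ℝ) :=
    aestronglyMeasurable_const
  have hi1 : Integrable fun x => ρ x * -Real.log (g x) :=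
    (pdf.integrable_pdf_smul_iff hlogm).2 hlog.neg
  have hi2 : Integrable ρ := by
    have h : Integrable (fun x => ρ x • (1 : ℝ)) :=
      (pdf.integrable_pdf_smul_iff hone).2 (integrable_const _)
    simpa using h
  have he1 : ∫ x, ρ x * -Real.log (g x) = ∫ ω, -Real.log (g (X ω)) ∂P :=
    pdf.integral_pdf_smul hlogm
  have he2 : ∫ x, ρ x = 1 := by
    have h : ∫ x, ρ x • (1 : ℝ) = ∫ _, (1 : ℝ) ∂P := pdf.integral_pdf_smul hone
    simpa using h
  -- The correction `g - ρ` has integral at most `0`, and `log u ≤ u - 1` at `u = g / ρ` makes `w` a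
  -- pointwise majorant of the entropy integrand.
  set w : ℝ → ℝ := fun x => ρ x * -Real.log (g x) + g x - ρ x with hw
  have hwi : Integrable w := (hi1.add hgi).sub hi2
  have hwint : ∫ x, w x ≤ ∫ ω, -Real.log (g (X ω)) ∂P := by
    have h1 : ∫ x, w x = (∫ x, (ρ x * -Real.log (g x) + g x)) - ∫ x, ρ x :=
      integral_sub (hi1.add hgi) hi2
    rw [h1, integral_add hi1 hgi, he1, he2]
    linarith
  have hle : ∀ x, entropyIntegrand P X x ≤ w x := by
    intro x
    have hρ0 : 0 ≤ ρ x := ENNReal.toReal_nonneg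
    change Real.negMulLog (ρ x) ≤ _
    simp only [hw, Real.negMulLog]
    rcases hρ0.eq_or_lt with h | h
    · rw [← h]
      simp [(hg x).le]
    · have h1 := Real.log_le_sub_one_of_pos (div_pos (hg x) h)
      rw [Real.log_div (hg x).ne' h.ne'] at h1
      have h2 := mul_le_mul_of_nonneg_left h1 h.le
      have h3 : ρ x * (g x / ρ x - 1) = g x - ρ x := by field_simp
      rw [h3] at h2
      linarith
  have hpos : entropyPos P X ≠ ∞ :=
    ne_top_of_le_ne_top hwi.lintegral_lt_top.ne
      (lintegral_mono fun x => ENNReal.ofReal_le_ofReal (hle x))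
  refine ⟨hpos, ?_⟩
  -- An infinite negative part makes the entropy `⊥`, as the positive part is finite.
  by_cases hneg : entropyNeg P X = ∞
  · rw [diffEntropy, hneg]
    lift entropyPos P X to ℝ≥0 using hpos with a
    simp
  have hmeas : Measurable (entropyIntegrand P X) :=
    Real.continuous_negMulLog.measurable.comp (measurable_pdf X P volume).ennreal_toReal
  have hint : Integrable (entropyIntegrand P X) := by
    refine ⟨hmeas.aestronglyMeasurable, ?_⟩
    rw [hasFiniteIntegral_iff_norm]
    have : ∀ x, ENNReal.ofReal ‖entropyIntegrand P X x‖ =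
        ENNReal.ofReal (entropyIntegrand P X x) + ENNReal.ofReal (-entropyIntegrand P X x) := by
      intro x
      rcases le_total 0 (entropyIntegrand P X x) with h | h
      · rw [Real.norm_of_nonneg h, ENNReal.ofReal_of_nonpos (neg_nonpos.2 h), add_zero]
      · rw [Real.norm_of_nonpos h, ENNReal.ofReal_of_nonpos h, zero_add]
    simp_rw [this]
    rw [lintegral_add_left hmeas.ennreal_ofReal]
    exact ENNReal.add_lt_top.2 ⟨lt_top_iff_ne_top.2 hpos, lt_top_iff_ne_top.2 hneg⟩
  have heq : diffEntropy P X = ((∫ x, entropyIntegrand P X x : ℝ) : EReal) := by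
    rw [integral_eq_lintegral_pos_part_sub_lintegral_neg_part hint, EReal.coe_sub]
    exact (congrArg₂ (· - ·) (EReal.coe_ennreal_toReal hpos)
      (EReal.coe_ennreal_toReal hneg)).symm
  rw [heq]
  exact EReal.coe_le_coe_iff.2 ((integral_mono hint hwi hle).trans hwint)

/-- The entropy bound given by comparison with a Cauchy density of scale `a`. -/
theorem diffEntropy_le_of_logMoment_ne_top {X : Ω → ℝ} (hXm : Measurable X)
    (hX : HasPDF X P volume) (hlog : logMoment P X ≠ ∞) {a : ℝ≥0} (ha : 0 < a) :
    entropyPos P X ≠ ∞ ∧ diffEntropy P X ≤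
      ((Real.log Real.pi + Real.log a +
        ∫ ω, 2 * Real.log (1 + |(a : ℝ)⁻¹ * X ω|) ∂P : ℝ) : EReal) := by
  have ha' : (0 : ℝ) < a := NNReal.coe_pos.2 ha
  have hlogg : ∀ x, Real.log (cauchyPDFReal 0 a x) =
      -(Real.log Real.pi + Real.log a + Real.log (1 + ((a : ℝ)⁻¹ * x) ^ 2)) := by
    intro x
    rw [cauchyPDFReal_def', sub_zero, NNReal.coe_inv,
      Real.log_mul (by positivity) (by positivity), Real.log_mul (by positivity) (by positivity),
      Real.log_inv, Real.log_inv, Real.log_inv, div_eq_inv_mul]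
    ring
  have hi0 := integrable_of_logMoment_ne_top hXm hlog
  have hi1 : Integrable (fun ω => 2 * Real.log (1 + |(a : ℝ)⁻¹ * X ω|)) P := by
    refine Integrable.const_mul ?_ 2
    refine Integrable.mono' ((integrable_const (Real.log (1 + |(a : ℝ)⁻¹|))).add hi0)
      (Measurable.aestronglyMeasurable (by fun_prop)) (Eventually.of_forall fun ω => ?_)
    rw [Real.norm_of_nonneg (log_one_add_abs_nonneg _)]
    exact log_one_add_abs_mul_le _ _
  have hi2 : Integrable (fun ω => Real.log (1 + ((a : ℝ)⁻¹ * X ω) ^ 2)) P := by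
    refine Integrable.mono' hi1 (Measurable.aestronglyMeasurable (by fun_prop))
      (Eventually.of_forall fun ω => ?_)
    rw [Real.norm_of_nonneg (Real.log_nonneg (by nlinarith [sq_nonneg ((a : ℝ)⁻¹ * X ω)]))]
    exact log_one_add_sq_le _
  have hi3 : Integrable (fun ω => Real.log (cauchyPDFReal 0 a (X ω))) P := by
    simp_rw [hlogg]
    exact ((integrable_const _).add hi2).neg
  obtain ⟨h1, h2⟩ := entropyPos_ne_top_and_diffEntropy_le hX (cauchyPDF_pos 0 ha.ne')
    (measurable_cauchyPDFReal 0 a) (integrable_cauchyPDFReal 0)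
    (integral_cauchyPDFReal_eq_one 0 ha.ne').le hi3
  refine ⟨h1, h2.trans (EReal.coe_le_coe_iff.2 ?_)⟩
  simp_rw [hlogg, neg_neg]
  rw [integral_add (integrable_const _) hi2]
  simp only [integral_const, probReal_univ, one_smul]
  refine add_le_add_right ?_ _
  exact integral_mono hi2 hi1 fun ω => log_one_add_sq_le _

end

/-! ### Small-time asymptotics -/

variable {Ω : Type*} [MeasurableSpace Ω] {P : Measure Ω} [IsProbabilityMeasure P]
  {L : ℝ≥0 → Ω → ℝ}

theorem integral_log_scaled_le {X : Ω → ℝ} (hX : Measurable X) (hlog : logMoment P X ≠ ∞)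
    (c : ℝ) :
    ∫ ω, 2 * Real.log (1 + |c * X ω|) ∂P ≤
      2 * (Real.log 2 + P.real {ω | 1 < |c * X ω|} * Real.log (1 + |c|) +
        (logMoment P X).toReal) := by
  set E : Set Ω := {ω | 1 < |c * X ω|} with hE_def
  have hE : MeasurableSet E := measurableSet_lt measurable_const (by fun_prop)
  have hi := integrable_of_logMoment_ne_top hX hlog
  have hiE : Integrable (E.indicator fun _ => Real.log (1 + |c|)) P :=
    (integrable_const _).indicator hE
  have hbound : ∀ ω, Real.log (1 + |c * X ω|) ≤
      Real.log 2 + E.indicator (fun _ => Real.log (1 + |c|)) ω + Real.log (1 + |X ω|) := by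
    intro ω
    have h1 := log_one_add_abs_nonneg (X ω)
    by_cases h : ω ∈ E
    · rw [Set.indicator_of_mem h]
      have h2 := log_one_add_abs_mul_le c (X ω)
      have h3 := Real.log_nonneg one_le_two
      linarith
    · rw [Set.indicator_of_notMem h]
      have h2 : |c * X ω| ≤ 1 := not_lt.1 h
      have h3 := Real.log_le_log (by positivity) (show 1 + |c * X ω| ≤ 2 by linarith)
      linarith
  rw [integral_const_mul]
  refine mul_le_mul_of_nonneg_left ?_ zero_le_two
  calc ∫ ω, Real.log (1 + |c * X ω|) ∂P
      ≤ ∫ ω, (Real.log 2 + E.indicator (fun _ => Real.log (1 + |c|)) ω +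
          Real.log (1 + |X ω|)) ∂P :=
        integral_mono_of_nonneg (Eventually.of_forall fun _ => log_one_add_abs_nonneg _)
          (((integrable_const _).add hiE).add hi) (Eventually.of_forall hbound)
    _ = (∫ ω, (Real.log 2 + E.indicator (fun _ => Real.log (1 + |c|)) ω) ∂P) +
          ∫ ω, Real.log (1 + |X ω|) ∂P := integral_add ((integrable_const _).add hiE) hi
    _ = _ := by
      rw [integral_add (integrable_const _) hiE, integral_indicator_const _ hE,
        integral_eq_toReal_logMoment hX]
      simp

theorem tendsto_log_one_div_nhdsGT_zero :
    Tendsto (fun t : ℝ≥0 => Real.log (1 / (t : ℝ))) (𝓝[>] 0) atTop := by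
  have h : Tendsto (fun t : ℝ≥0 => (t : ℝ)) (𝓝[>] 0) (𝓝[≠] 0) := by
    refine tendsto_nhdsWithin_iff.2 ⟨?_, ?_⟩
    · exact (NNReal.continuous_coe.tendsto 0).mono_left nhdsWithin_le_nhds
    · filter_upwards [self_mem_nhdsWithin] with t ht
      exact (NNReal.coe_pos.2 ht).ne'
  refine (tendsto_neg_atBot_atTop.comp (Real.tendsto_log_nhdsNE_zero.comp h)).congr fun t => ?_
  simp

/-- If `t ^ (-α) * L t` tends to `0` in probability, the normalised entropy has upper limit at
most `-α`. -/
theorem IsLevyProcess.limsup_diffEntropy_div_log_le (hL : IsLevyProcess P L)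
    (hac : ∀ t : ℝ≥0, 0 < t → HasPDF (L t) P volume) (h1 : logMoment P (L 1) ≠ ∞)
    {α : ℝ} (hα : 0 ≤ α)
    (hP : Tendsto (fun t : ℝ≥0 => P.real {ω | 1 < |(t : ℝ) ^ (-α) * L t ω|}) (𝓝[>] 0) (𝓝 0)) :
    limsup (fun t : ℝ≥0 => diffEntropy P (L t) / ((Real.log (1 / (t : ℝ)) : ℝ) : EReal))
      (𝓝[>] 0) ≤ ((-α : ℝ) : EReal) := by
  obtain ⟨K, hK, hev⟩ := hL.exists_eventually_logMoment_le h1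
  set ℓ : ℝ≥0 → ℝ := fun t => Real.log (1 / (t : ℝ)) with hℓ
  set ε : ℝ≥0 → ℝ := fun t => P.real {ω | 1 < |(t : ℝ) ^ (-α) * L t ω|} with hε
  have hℓlim : Tendsto ℓ (𝓝[>] 0) atTop := tendsto_log_one_div_nhdsGT_zero
  set B : ℝ≥0 → ℝ := fun t =>
    -α + (Real.log Real.pi + 2 * Real.log 2 + 2 * K.toReal) / ℓ t +
      2 * ε t * (Real.log 2 / ℓ t + α) with hB
  have hBlim : Tendsto B (𝓝[>] 0) (𝓝 (-α)) := by
    have h2 := (hℓlim.const_div_atTop (Real.log Real.pi + 2 * Real.log 2 + 2 * K.toReal)).const_add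
      (-α)
    have h3 := (hP.const_mul 2).mul ((hℓlim.const_div_atTop (Real.log 2)).add_const α)
    simpa using h2.add h3
  have hle : ∀ᶠ t : ℝ≥0 in 𝓝[>] 0,
      diffEntropy P (L t) / ((ℓ t : ℝ) : EReal) ≤ ((B t : ℝ) : EReal) := by
    filter_upwards [hev, hℓlim.eventually_gt_atTop 0, self_mem_nhdsWithin] with t htK htℓ ht
    have ht' : (0 : ℝ) < t := NNReal.coe_pos.2 ht
    have htop : logMoment P (L t) ≠ ∞ := ne_top_of_le_ne_top hK htK
    -- The logarithm of the scale `t ^ α` is the source of the leading term `-α * ℓ t`.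
    have hent := (diffEntropy_le_of_logMoment_ne_top (hL.measurable t) (hac t ht) htop
      (NNReal.rpow_pos ht : 0 < t ^ α)).2
    have hc : ((t ^ α : ℝ≥0) : ℝ)⁻¹ = (t : ℝ) ^ (-α) := by
      rw [NNReal.coe_rpow, Real.rpow_neg ht'.le]
    have hlogt : Real.log (t : ℝ) = -ℓ t := by simp [hℓ]
    rw [hc, NNReal.coe_rpow, Real.log_rpow ht', hlogt] at hent
    have hlogc : Real.log (1 + |(t : ℝ) ^ (-α)|) ≤ Real.log 2 + α * ℓ t := by
      have hpos : 0 < (t : ℝ) ^ (-α) := Real.rpow_pos_of_pos ht' _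
      have ht1 : (t : ℝ) ≤ 1 := by
        by_contra! h
        have := Real.log_pos h
        linarith
      have hone : 1 ≤ (t : ℝ) ^ (-α) :=
        Real.one_le_rpow_of_pos_of_le_one_of_nonpos ht' ht1 (by linarith)
      have h2 : Real.log (1 + |(t : ℝ) ^ (-α)|) ≤ Real.log (2 * (t : ℝ) ^ (-α)) := by
        rw [abs_of_pos hpos]
        exact Real.log_le_log (by positivity) (by linarith)
      rw [Real.log_mul two_ne_zero hpos.ne', Real.log_rpow ht', hlogt] at h2
      linarith
    have hint := integral_log_scaled_le (hL.measurable t) htop ((t : ℝ) ^ (-α))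
    have hKt : (logMoment P (L t)).toReal ≤ K.toReal := ENNReal.toReal_mono hK htK
    have hεt : 0 ≤ ε t := measureReal_nonneg
    have hmul := mul_le_mul_of_nonneg_left hlogc hεt
    have hreal : Real.log Real.pi + α * -ℓ t +
        ∫ ω, 2 * Real.log (1 + |(t : ℝ) ^ (-α) * L t ω|) ∂P ≤ B t * ℓ t := by
      have hBt : B t * ℓ t = -α * ℓ t + (Real.log Real.pi + 2 * Real.log 2 + 2 * K.toReal) +
          2 * (ε t * (Real.log 2 + α * ℓ t)) := by
        simp only [hB]
        field_simp
      rw [hBt]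
      linarith
    rw [EReal.div_le_iff_le_mul (EReal.coe_pos.2 htℓ) (EReal.coe_ne_top _), mul_comm,
      ← EReal.coe_mul]
    exact hent.trans (EReal.coe_le_coe_iff.2 hreal)
  refine (limsup_le_limsup hle).trans ?_
  exact (((continuous_coe_real_ereal.tendsto _).comp hBlim).limsup_eq).le

end LevyEntropy

theorem theorem4p2 {Ω : Type*} [MeasurableSpace Ω] (P : Measure Ω) [IsProbabilityMeasure P]
    (L : ℝ≥0 → Ω → ℝ) (hL : LevyEntropy.IsLevyProcess P L)
    (hac : ∀ t : ℝ≥0, 0 < t → HasPDF (L t) P volume)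
    (p : ℝ) (hp : 0 < p) (hmom : Integrable (fun ω => |L 1 ω| ^ p) P) :
    (∀ t : ℝ≥0, 0 < t →
      LevyEntropy.HasDiffEntropy P (L t) ∧ LevyEntropy.diffEntropy P (L t) < ⊤) ∧
    limsup (fun t : ℝ≥0 => LevyEntropy.diffEntropy P (L t) / ((Real.log (1 / (t : ℝ)) : ℝ) : EReal))
      (𝓝[>] 0) ≤ -(((LevyEntropy.bgIndex P L)⁻¹ : ℝ≥0∞) : EReal) ∧
    (LevyEntropy.bgIndex P L = 0 →
      Tendsto
        (fun t : ℝ≥0 => LevyEntropy.diffEntropy P (L t) / ((Real.log (1 / (t : ℝ)) : ℝ) : EReal))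
        (𝓝[>] 0) (𝓝 ⊥)) := by
  have h1 : LevyEntropy.logMoment P (L 1) ≠ ∞ :=
    LevyEntropy.logMoment_ne_top_of_integrable_rpow (hL.measurable 1) hp hmom
  have hlimsup : limsup (fun t : ℝ≥0 =>
      LevyEntropy.diffEntropy P (L t) / ((Real.log (1 / (t : ℝ)) : ℝ) : EReal))
      (𝓝[>] 0) ≤ -(((LevyEntropy.bgIndex P L)⁻¹ : ℝ≥0∞) : EReal) := by
    set S := limsup (fun t : ℝ≥0 =>
      LevyEntropy.diffEntropy P (L t) / ((Real.log (1 / (t : ℝ)) : ℝ) : EReal)) (𝓝[>] 0)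
      with hS
    -- The case `α = 0` covers an infinite index and makes `-S` nonnegative, so `toENNReal` loses
    -- nothing.
    have hS0 : S ≤ 0 := by
      have h := hL.limsup_diffEntropy_div_log_le hac h1 le_rfl
        (by simpa using hL.tendsto_measureReal_abs_gt)
      rwa [neg_zero, EReal.coe_zero] at h
    have hSq : (LevyEntropy.bgIndex P L)⁻¹ ≤ (-S).toENNReal := by
      -- Inversion turns the infimum into a supremum, so each admissible `q` can be treated
      -- separately and none need attain the index.
      rw [LevyEntropy.bgIndex, ENNReal.inv_sInf]
      refine iSup₂_le fun b hb => ?_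
      obtain ⟨q, ⟨hq, hlim⟩, rfl⟩ := hb
      have h := hL.limsup_diffEntropy_div_log_le hac h1 (inv_nonneg.2 hq.le)
        (hL.tendsto_measureReal_abs_gt_scaled hq hlim)
      rw [← hS, EReal.coe_neg] at h
      have h2 : ((q⁻¹ : ℝ) : EReal) ≤ -S := EReal.le_neg_of_le_neg h
      have h3 := EReal.toENNReal_le_toENNReal h2
      rwa [EReal.toENNReal_of_ne_top (EReal.coe_ne_top _), EReal.toReal_coe,
        ENNReal.ofReal_inv_of_pos hq] at h3
    refine EReal.le_neg_of_le_neg ?_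
    have h0 : 0 ≤ -S := EReal.le_neg_of_le_neg (by simpa using hS0)
    rw [← EReal.coe_toENNReal h0]
    exact EReal.coe_ennreal_le_coe_ennreal_iff.2 hSq
  refine ⟨fun t ht => ?_, hlimsup, fun h0 => ?_⟩
  · obtain ⟨hpos, hle⟩ := LevyEntropy.diffEntropy_le_of_logMoment_ne_top
      (hL.measurable t) (hac t ht) (hL.logMoment_ne_top h1 t ht) one_pos
    exact ⟨⟨hac t ht, Or.inl hpos⟩, hle.trans_lt (EReal.coe_lt_top _)⟩
  · rw [h0, ENNReal.inv_zero, EReal.coe_ennreal_top, EReal.neg_top] at hlimsup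
    exact tendsto_of_le_liminf_of_limsup_le bot_le hlimsup
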